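/- Let $\rho\colon\{a_{11},a_{12},a_{21},a_{22}\}^*\to\{0,1\}^*$ be the $13$-uniform morphism $$a_{11}\mapsto 0010010110011,\quad a_{12}\mapsto 0010011010011,\quad a_{21}\mapsto 0010110010011,\quad a_{22}\mapsto 0100101001011 .$$ Each of the four images has seven letters $0$ and six letters $1$, and $\rho$ is cubefree, i.e. $\rho(w)$ is cubefree (contains no factor $uuu$ with $u$ non-empty) for every cubefree word $w$. Hence in $\rho(w)$, for every non-empty finite word $w$, the letters $0$ and $1$ have frequencies $7/13$ and $6/13$. Moreover, for $(f_0,f_1)=(7/13,6/13)$, and likewise for $(f_0,f_1)=(6/13,7/13)$, the set of binary cubefree words with letter frequencies $f_0$ and $f_1$ has positive entropy, bounded below by $\frac16\log 2$, both for finite words and for infinite words: (a) The set of finite cubefree words $w\in\{0,1\}^*$ in which each letter $b$ has frequency $\#_b(w)/|w|=f_b$ is infinite, and if $c(n)$ is the number of its elements of length $n$, then $\liminf \frac1n\log c(n)\ge\frac16\log 2$, where $n\to\infty$ through the lengths with $c(n)\neq0$. (b) For an infinite word $x$, let the upper (lower) frequency of a letter $b$ be the supremum (infimum), over all sequences $(w_n)$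 with $w_n$ a factor of $x$ of length $n$, of $\limsup_n \#_b(w_n)/n$ (of $\liminf_n \#_b(w_n)/n$); $b$ has frequency $f_b$ in $x$ if both equal $f_b$. The set $X$ of all finite factors of infinite cubefree words over $\{0,1\}$ in which $0$ and $1$ have frequencies $f_0$ and $f_1$ is infinite and factorial (closed under taking factors), and its entropy $h(X)=\lim_{n\to\infty}\frac1n\log c_X(n)$, where $c_X(n)$ is the number of words of length $n$ in $X$, exists and satisfies $h(X)\ge\frac16\log 2$. -/

import Mathlib

namespace PowerFree

/-! Words over an alphabet are lists, infinite words are sequences indexed by the naturals. A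
morphism of free monoids is given by the images `σ a` of the letters; the image of a word `w`
is `w.flatMap σ`. -/

/-- `w` is `k`-powerfree: no factor of `w` is the `k`-th power of a nonempty word. -/
def IsPowerFree {α : Type*} (k : ℕ) (w : List α) : Prop :=
  ∀ u : List α, u ≠ [] → ¬ (List.replicate k u).flatten <:+: w

/-- The morphism given by `σ` is `ℓ`-uniform. -/
def IsUniform {α β : Type*} (ℓ : ℕ) (σ : α → List β) : Prop :=
  ∀ a, (σ a).length = ℓ

/-- The morphism given by `σ` maps `k`-powerfree words to `k`-powerfree words. -/
def IsPowerFreeMorphism {α β : Type*} (k : ℕ) (σ : α → List β) : Prop :=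
  ∀ w : List α, IsPowerFree k w → IsPowerFree k (w.flatMap σ)

/-- The frequency of the letter `a` in a finite word (`0` for the empty word). -/
noncomputable def freq {α : Type*} [DecidableEq α] (a : α) (w : List α) : ℝ :=
  (w.count a : ℝ) / (w.length : ℝ)

/-- The factor of length `n` at position `i` of an infinite word. -/
def block {α : Type*} (x : ℕ → α) (i n : ℕ) : List α :=
  List.ofFn fun j : Fin n => x (i + j)

/-- An infinite word is `k`-powerfree if all its finite factors are. -/
def IsPowerFreeSeq {α : Type*} (k : ℕ) (x : ℕ → α) : Prop :=
  ∀ i n, IsPowerFree k (block x i n)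

/-- The upper frequency of a letter in an infinite word: the supremum, over all choices of an
`n`-letter factor for every `n`, of the limsup of the frequencies in these factors. -/
noncomputable def upperFreq {α : Type*} [DecidableEq α] (a : α) (x : ℕ → α) : ℝ :=
  ⨆ s : ℕ → ℕ, Filter.limsup (fun n => freq a (block x (s n) n)) Filter.atTop

/-- The lower frequency of a letter in an infinite word. -/
noncomputable def lowerFreq {α : Type*} [DecidableEq α] (a : α) (x : ℕ → α) : ℝ :=
  ⨅ s : ℕ → ℕ, Filter.liminf (fun n => freq a (block x (s n) n)) Filter.atTop

/-- The letter `a` has frequency `f` in the infinite word `x`. -/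
def HasFreq {α : Type*} [DecidableEq α] (a : α) (x : ℕ → α) (f : ℝ) : Prop :=
  upperFreq a x = f ∧ lowerFreq a x = f

/-- A set of words is factorial if it contains all factors of its members. -/
def IsFactorial {α : Type*} (X : Set (List α)) : Prop :=
  ∀ w ∈ X, ∀ v : List α, v <:+: w → v ∈ X

/-- The number of words of length `n` in `X` (for a finite alphabet). -/
noncomputable def complexity {α : Type*} (X : Set (List α)) (n : ℕ) : ℕ :=
  {w ∈ X | w.length = n}.ncard

/-- `h` is the entropy of the (infinite, factorial) set `X`. -/
def HasEntropy {α : Type*} (X : Set (List α)) (h : ℝ) : Prop :=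
  Filter.Tendsto (fun n : ℕ => Real.log (complexity X n) / n) Filter.atTop (nhds h)

/-- The lower entropy of an infinite set of words that need not be factorial: the lower limit
of `log c(n) / n` along those lengths `n` for which the set has a word of length `n`. -/
noncomputable def lowerEntropy {α : Type*} (X : Set (List α)) : EReal :=
  Filter.liminf (fun n : ℕ => ((Real.log (complexity X n) / n : ℝ) : EReal))
    (Filter.atTop ⊓ Filter.principal {n : ℕ | ∃ w ∈ X, w.length = n})

/-- The finite `k`-powerfree words in which every letter `b` has frequency exactly `f b`. -/
def wordsWithFreq {α : Type*} [DecidableEq α] (k : ℕ) (f : α → ℝ) : Set (List α) :=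
  {w | IsPowerFree k w ∧ ∀ b, freq b w = f b}

/-- The factors of the infinite `k`-powerfree words in which every letter `b` has
frequency `f b`. -/
def factorsWithFreq {α : Type*} [DecidableEq α] (k : ℕ) (f : α → ℝ) : Set (List α) :=
  {v | ∃ x : ℕ → α, IsPowerFreeSeq k x ∧ (∀ b, HasFreq b x (f b)) ∧ ∃ i n, v = block x i n}

/-- The four-letter alphabet. -/
inductive Letter where
  | a11 | a12 | a21 | a22

/-- The images of the letters under the explicit 13-uniform morphism. -/
def rho : Letter → List (Fin 2)
  | Letter.a11 => [0, 0, 1, 0, 0, 1, 0, 1, 1, 0, 0, 1, 1]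
  | Letter.a12 => [0, 0, 1, 0, 0, 1, 1, 0, 1, 0, 0, 1, 1]
  | Letter.a21 => [0, 0, 1, 0, 1, 1, 0, 0, 1, 0, 0, 1, 1]
  | Letter.a22 => [0, 1, 0, 0, 1, 0, 1, 0, 0, 1, 0, 1, 1]

end PowerFree

namespace PowerFree

/-! The entropy bounds do not come from `rho`. They come from two 13-uniform morphisms on five
letters, whose images have 7 zeros and 6 ones, or 6 and 7. Both these morphisms and `rho` preserve
cubefreeness, by one criterion.

Criterion: suppose the image of `x` has a cube of period `p`. Short periods not divisible by 13 are
excluded by finite search. For long ones, the cube repeats a block of full images at an offset not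
divisible by 13, which a finite synchronization test forbids. So `p = 13 * q`, and injectivity on
letters pulls the cube back to `x`, except for one letter cut by the ends; a border condition
settles that letter. The pulled-back cube is located precisely enough to treat finite words as
prefixes of infinite ones (`exists_isCubeAt_of_substSeq`).

Counting: over five letters, the number of cubefree words grows by a factor of at least 9/2 per
letter (`growth_of_recursion`). A compactness argument gives `(9 / 2) ^ n` also for prefixes of
infinite cubefree words (`pow_le_ncard_prefixes`).

Transfer: the morphisms are injective and every image has the same letter counts, so there are at
least `(9 / 2) ^ n` suitable binary words of length `13 * n`. Since `2 ^ 13 ≤ (9 / 2) ^ 6`, this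
gives `log 2 / 6`. -/

/-- The infinite word `x` has a cube of period `p` at position `s`. -/
def IsCubeAt {α : Type*} (x : ℕ → α) (s p : ℕ) : Prop :=
  ∀ i < 2 * p, x (s + i) = x (s + i + p)

/-- The image of an infinite word under the `ℓ`-uniform morphism for which `σ a t` is the letter
at position `t` of the image of `a`. -/
def substSeq {α β : Type*} (σ : α → ℕ → β) (ℓ : ℕ) (x : ℕ → α) : ℕ → β :=
  fun i => σ (x (i / ℓ)) (i % ℓ)

/-! ### A criterion for uniform morphisms to reflect cubes -/

section Criterion

variable {α β : Type*} {σ : α → ℕ → β} {ℓ : ℕ}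

theorem substSeq_mul_add (hℓ : 0 < ℓ) (x : ℕ → α) (k i : ℕ) :
    substSeq σ ℓ x (k * ℓ + i) = substSeq σ ℓ (fun j => x (k + j)) i := by
  simp [substSeq, Nat.add_mod, Nat.mul_comm k ℓ, Nat.mul_add_div hℓ]

theorem substSeq_mul_add_of_lt (hℓ : 0 < ℓ) (x : ℕ → α) (k : ℕ) {t : ℕ} (ht : t < ℓ) :
    substSeq σ ℓ x (k * ℓ + t) = σ (x k) t := by
  rw [substSeq_mul_add hℓ]
  simp [substSeq, Nat.div_eq_of_lt ht, Nat.mod_eq_of_lt ht]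

/-- For `p ≥ P`, the first image boundary at or after `s` is followed by `m` full images within the
`2 * p` positions where the cube compares letters `p` apart: at most `ℓ - 1 + m * ℓ ≤ 2 * P`
positions are needed. They recur at offset `p % ℓ`, against `hsync`. -/
theorem dvd_of_isCubeAt_substSeq {m P : ℕ} (hℓ : 0 < ℓ) (hmP : (m + 1) * ℓ ≤ 2 * P + 1)
    (hshort : ∀ x s p, s < ℓ → p < P → ¬ ℓ ∣ p → ¬ IsCubeAt (substSeq σ ℓ x) s p)
    (hsync : ∀ x x' r, 0 < r → r < ℓ →
      ∃ t < m * ℓ, substSeq σ ℓ x t ≠ substSeq σ ℓ x' (r + t))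
    {x : ℕ → α} {s p : ℕ} (h : IsCubeAt (substSeq σ ℓ x) s p) : ℓ ∣ p := by
  by_contra hd
  have hs : s / ℓ * ℓ + s % ℓ = s := Nat.div_add_mod' s ℓ
  have hslt : s % ℓ < ℓ := Nat.mod_lt _ hℓ
  by_cases hp : p < P
  · refine hshort (fun j => x (s / ℓ + j)) (s % ℓ) p hslt hp hd fun i hi => ?_
    have := h i hi
    rw [← hs, add_assoc, add_assoc, substSeq_mul_add hℓ, substSeq_mul_add hℓ] at this
    exact this
  · have hple : p / ℓ * ℓ + p % ℓ = p := Nat.div_add_mod' p ℓ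
    have hr : 0 < p % ℓ := Nat.pos_of_ne_zero fun h0 => hd (Nat.dvd_of_mod_eq_zero h0)
    obtain ⟨k, hk1, hk2⟩ : ∃ k, s ≤ k * ℓ ∧ k * ℓ < s + ℓ := by
      by_cases h0 : s % ℓ = 0
      · exact ⟨s / ℓ, by omega, by omega⟩
      · exact ⟨s / ℓ + 1, by rw [add_mul]; omega, by rw [add_mul]; omega⟩
    obtain ⟨t, ht, hne⟩ := hsync (fun j => x (k + j)) (fun j => x (k + p / ℓ + j)) (p % ℓ) hr
      (Nat.mod_lt _ hℓ)
    apply hne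
    have e := h (k * ℓ - s + t) (by rw [add_mul] at hmP; omega)
    rw [← substSeq_mul_add hℓ, ← substSeq_mul_add hℓ]
    have e1 : s + (k * ℓ - s + t) = k * ℓ + t := by omega
    have e2 : (k + p / ℓ) * ℓ + (p % ℓ + t) = k * ℓ + t + p := by rw [add_mul]; omega
    rw [e1] at e
    rw [e2, e]

/-- With `p = ℓ * q` and `s = j * ℓ + r`, injectivity gives `x k = x (k + q)` for `j < k < j + 2 *
q`. One more equality is needed, at either end. The image of `x (j + q)` shares its suffix from `r`
with that of `x j` and its prefix of length `r` with that of `x (j + 3 * q)`, so `hfix` places the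
cube at `j` or at `j + 1`. The length bound keeps it inside a finite word whose image contains the
original cube. -/
theorem exists_isCubeAt_of_substSeq {m P : ℕ} (hℓ : 0 < ℓ) (hmP : (m + 1) * ℓ ≤ 2 * P + 1)
    (hshort : ∀ x s p, s < ℓ → p < P → ¬ ℓ ∣ p → ¬ IsCubeAt (substSeq σ ℓ x) s p)
    (hsync : ∀ x x' r, 0 < r → r < ℓ →
      ∃ t < m * ℓ, substSeq σ ℓ x t ≠ substSeq σ ℓ x' (r + t))
    (hinj : ∀ a b, (∀ t < ℓ, σ a t = σ b t) → a = b)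
    (hfix : ∀ a b c r, r < ℓ → (∀ t, r ≤ t → t < ℓ → σ b t = σ a t) →
      (∀ t < r, σ a t = σ c t) → b = a ∨ a = c)
    {x : ℕ → α} {s p : ℕ} (hp : 0 < p) (h : IsCubeAt (substSeq σ ℓ x) s p) :
    ∃ j q, 0 < q ∧ IsCubeAt x j q ∧ (j + 3 * q) * ℓ < s + 3 * p + ℓ := by
  obtain ⟨q, rfl⟩ := dvd_of_isCubeAt_substSeq hℓ hmP hshort hsync h
  have hq : 0 < q := Nat.pos_of_mul_pos_left hp
  obtain ⟨j, r, hr, rfl⟩ : ∃ j r, r < ℓ ∧ s = j * ℓ + r :=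
    ⟨s / ℓ, s % ℓ, Nat.mod_lt _ hℓ, (Nat.div_add_mod' s ℓ).symm⟩
  have key : ∀ k t, t < ℓ → j * ℓ + r ≤ k * ℓ + t → k * ℓ + t < (j + 2 * q) * ℓ + r →
      σ (x k) t = σ (x (k + q)) t := by
    intro k t ht h1 h2
    have e := h (k * ℓ + t - (j * ℓ + r)) (by
      have : (j + 2 * q) * ℓ = j * ℓ + 2 * (ℓ * q) := by ring
      omega)
    have e1 : j * ℓ + r + (k * ℓ + t - (j * ℓ + r)) = k * ℓ + t := by omega
    have e2 : k * ℓ + t + ℓ * q = (k + q) * ℓ + t := by ring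
    rwa [e1, e2, substSeq_mul_add_of_lt hℓ x k ht, substSeq_mul_add_of_lt hℓ x (k + q) ht] at e
  have full : ∀ k, j * ℓ + r ≤ k * ℓ → k < j + 2 * q → x k = x (k + q) := by
    intro k h1 h2
    refine hinj _ _ fun t ht => key k t ht (by omega) ?_
    have : (k + 1) * ℓ ≤ (j + 2 * q) * ℓ := Nat.mul_le_mul_right _ h2
    rw [add_mul] at this
    omega
  have inner : ∀ k, j < k → k < j + 2 * q → x k = x (k + q) := by
    intro k h1 h2
    refine full k ?_ h2
    have : (j + 1) * ℓ ≤ k * ℓ := Nat.mul_le_mul_right _ h1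
    rw [add_mul] at this
    omega
  have hlen : (j + 3 * q) * ℓ = j * ℓ + 3 * (ℓ * q) := by ring
  have first : x j = x (j + q) → IsCubeAt x j q := by
    intro h0 i hi
    rcases Nat.eq_zero_or_pos i with rfl | hi0
    · simpa using h0
    · exact inner (j + i) (by omega) (by omega)
  rcases Nat.eq_zero_or_pos r with rfl | hr0
  · exact ⟨j, q, hq, first (full j (by omega) (by omega)), by omega⟩
  · rcases hfix (x (j + q)) (x j) (x (j + 3 * q)) r hr
      (fun t h1 h2 => key j t h2 (by omega) (by
        have : (j + 1) * ℓ ≤ (j + 2 * q) * ℓ := Nat.mul_le_mul_right _ (by omega)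
        rw [add_mul] at this
        omega))
      (fun t ht => by
        have e := key (j + 2 * q) t (by omega) (by
          have : (j + 1) * ℓ ≤ (j + 2 * q) * ℓ := Nat.mul_le_mul_right _ (by omega)
          rw [add_mul] at this
          omega) (by omega)
        have e1 : j + q + q = j + 2 * q := by ring
        have e2 : j + 2 * q + q = j + 3 * q := by ring
        rw [inner (j + q) (by omega) (by omega), e1, e, e2]) with h0 | h0
    · exact ⟨j, q, hq, first h0, by omega⟩
    · refine ⟨j + 1, q, hq, fun i hi => ?_, ?_⟩
      · by_cases hi' : j + 1 + i < j + 2 * q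
        · exact inner _ (by omega) hi'
        · have e1 : j + 1 + i = j + q + q := by omega
          have e2 : j + q + q + q = j + 3 * q := by omega
          rw [e1, e2, ← h0]
          exact (inner (j + q) (by omega) (by omega)).symm
      · have : (j + 1 + 3 * q) * ℓ = j * ℓ + 3 * (ℓ * q) + ℓ := by ring
        omega

end Criterion

/-! ### Factors of infinite words and cubes by position -/

section Words

variable {α β : Type*}

@[simp] theorem length_block (x : ℕ → α) (i n : ℕ) : (block x i n).length = n := by
  simp [block]

theorem getElem_block (x : ℕ → α) (i n k : ℕ) (hk : k < (block x i n).length) :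
    (block x i n)[k] = x (i + k) := by
  simp [block]

theorem block_congr {x y : ℕ → α} {i j n : ℕ} (h : ∀ k < n, x (i + k) = y (j + k)) :
    block x i n = block y j n :=
  List.ext_getElem (by simp) fun k hk _ => by
    rw [getElem_block, getElem_block]
    exact h k (by simpa using hk)

theorem block_inj {x y : ℕ → α} {i j n : ℕ} (h : block x i n = block y j n) {k : ℕ}
    (hk : k < n) : x (i + k) = y (j + k) := by
  rw [← getElem_block x i n k (by simpa using hk), ← getElem_block y j n k (by simpa using hk)]
  simp only [h]

theorem block_add (x : ℕ → α) (i m n : ℕ) :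
    block x i (m + n) = block x i m ++ block x (i + m) n := by
  refine List.ext_getElem (by simp) fun k hk _ => ?_
  rw [List.getElem_append, getElem_block]
  split
  · rw [getElem_block]
  · rename_i h
    rw [getElem_block]
    simp only [length_block] at h ⊢
    congr 1
    omega

theorem block_isInfix (x : ℕ → α) {i n j m : ℕ} (h : j + m ≤ n) :
    block x (i + j) m <:+: block x i n := by
  refine ⟨block x i j, block x (i + j + m) (n - j - m), ?_⟩
  rw [← block_add, ← add_assoc i j m |>.symm, ← block_add]
  congr 1
  omega

theorem exists_eq_block_of_isInfix {x : ℕ → α} {i n : ℕ} {v : List α} (h : v <:+: block x i n) :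
    ∃ j, j + v.length ≤ n ∧ v = block x (i + j) v.length := by
  obtain ⟨s, t, hst⟩ := h
  have hl := congrArg List.length hst
  simp only [List.length_append, length_block] at hl
  refine ⟨s.length, by omega, ?_⟩
  rw [← hl, block_add, block_add] at hst
  have := List.append_inj_left hst (by simp)
  exact List.append_inj_right this (by simp)

theorem exists_eq_block [Inhabited α] (w : List α) : ∃ x : ℕ → α, w = block x 0 w.length :=
  ⟨fun i => w.getD i default, List.ext_getElem (by simp) fun k hk _ => by
    rw [getElem_block]; simp [hk]⟩

theorem IsPowerFree.of_isInfix {k : ℕ} {v w : List α} (hw : IsPowerFree k w) (h : v <:+: w) :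
    IsPowerFree k v :=
  fun u hu hv => hw u hu (hv.trans h)

theorem isPowerFree_block_iff {x : ℕ → α} {i n : ℕ} :
    IsPowerFree 3 (block x i n) ↔ ∀ s p, 0 < p → s + 3 * p ≤ n → ¬ IsCubeAt x (i + s) p := by
  constructor
  · intro h s p hp hn hc
    have h1 : block x (i + s + p) p = block x (i + s) p :=
      block_congr fun k hk => by rw [hc k (by omega)]; congr 1; omega
    have h2 : block x (i + s + p + p) p = block x (i + s) p :=
      block_congr fun k hk => by
        rw [hc k (by omega)]
        have := hc (p + k) (by omega)
        rw [show i + s + k + p = i + s + (p + k) by omega, this]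
        congr 1
        omega
    refine h (block x (i + s) p) (fun h0 => ?_) ?_
    · have := congrArg List.length h0
      simp at this
      omega
    · have h3 : (List.replicate 3 (block x (i + s) p)).flatten = block x (i + s) (p + p + p) := by
        rw [block_add, block_add, ← add_assoc, h1, h2]
        simp [List.replicate]
      rw [h3]
      exact block_isInfix x (by omega)
  · intro h u hu hin
    obtain ⟨j, hj, e⟩ := exists_eq_block_of_isInfix hin
    have hl : (List.replicate 3 u).flatten.length = 3 * u.length := by
      simp [List.replicate]; omega
    rw [hl] at hj e
    have hp : 0 < u.length := List.length_pos_iff.2 hu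
    refine h j u.length hp hj fun k hk => ?_
    rw [show 3 * u.length = u.length + u.length + u.length by ring, block_add, block_add] at e
    have e' : u ++ u ++ u = (List.replicate 3 u).flatten := by simp [List.replicate]
    rw [← e'] at e
    have e3 := List.append_inj_right e (by simp)
    have e12 := List.append_inj_left e (by simp)
    have e1 := List.append_inj_left e12 (by simp)
    have e2 := List.append_inj_right e12 (by simp)
    by_cases hk' : k < u.length
    · have := block_inj (e1.symm.trans e2) hk'
      rw [this]
      congr 1
      omega
    · have := block_inj (e2.symm.trans e3) (k := k - u.length) (by omega)
      rw [show i + j + k = i + j + u.length + (k - u.length) by omega, this]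
      congr 1
      omega

theorem isPowerFreeSeq_iff {x : ℕ → α} :
    IsPowerFreeSeq 3 x ↔ ∀ s p, 0 < p → ¬ IsCubeAt x s p := by
  constructor
  · intro h s p hp
    exact isPowerFree_block_iff.1 (h s (3 * p)) 0 p hp (by omega)
  · intro h i n
    exact isPowerFree_block_iff.2 fun s p hp _ => h _ p hp

end Words

/-! ### Finite tests by bit arithmetic -/

/-! Binary words of length 13 are encoded by natural numbers below `2 ^ 13`, the letter at
position `t` being the bit of weight `2 ^ t`. -/

/-- The binary word of length 13 encoded by `e`. -/
def binaryWord (e : ℕ) : List (Fin 2) :=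
  List.ofFn fun t : Fin 13 => if e.testBit t then 1 else 0

/-- The codes of the concatenations of `n` words with codes in `E`. -/
def concatCodes (E : List ℕ) : ℕ → List ℕ
  | 0 => [0]
  | n + 1 => (concatCodes E n).flatMap fun c => E.map fun e => 2 ^ 13 * c + e

/-- Successively replace `d` by the disjunction of `d` and `d` shifted by `k`, for `k` in `ks`. -/
def smear (d : ℕ) (ks : List ℕ) : ℕ :=
  ks.foldl (fun z k => z ||| z >>> k) d

/-- No concatenation of `N` words has a cube of period `p` starting in the first word. -/
def noCubeTest (E : List ℕ) (p N : ℕ) (ks : List ℕ) : Bool :=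
  decide (12 + 3 * p ≤ 13 * N) && decide (ks.sum < 2 * p) &&
    (concatCodes E N).all fun c => smear (c ^^^ (c >>> p)) ks % 2 ^ 13 == 2 ^ 13 - 1

/-- No concatenation of `m` words occurs in one of `m + 1` words at a position strictly between
`0` and `13`. -/
def syncTest (E : List ℕ) (m : ℕ) : Bool :=
  (concatCodes E m).all fun e => (concatCodes E (m + 1)).all fun c =>
    (List.range 12).all fun r => (c >>> (r + 1)) % 2 ^ (13 * m) != e % 2 ^ (13 * m)

/-- No word is composed of a suffix and a prefix of two others. -/
def borderTest (E : List ℕ) : Bool :=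
  E.all fun a => E.all fun b => E.all fun c => (List.range 13).all fun r =>
    !(b >>> r == a >>> r) || !(a % 2 ^ r == c % 2 ^ r) || b == a || a == c

/-- Bit `s` of the smear is the disjunction of the bits of `d` at `s + i`, for `i` a sum over a
sublist of `ks`; all such `i` are at most `ks.sum`. -/
theorem smear_testBit_eq_false {ks : List ℕ} {d s L : ℕ}
    (hd : ∀ i < L, d.testBit (s + i) = false) (hks : ks.sum < L) :
    (smear d ks).testBit s = false := by
  induction ks generalizing d L with
  | nil => simpa [smear] using hd 0 (by omega)
  | cons k ks ih =>
    rw [List.sum_cons] at hks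
    refine ih (d := d ||| d >>> k) (L := L - k) (fun i hi => ?_) (by omega)
    rw [Nat.testBit_or, Nat.testBit_shiftRight, hd i (by omega),
      show k + (s + i) = s + (k + i) by omega, hd (k + i) (by omega)]
    rfl

section

variable {α : Type*}

/-- The code of the concatenation of the first `n` images. -/
def concatCode (E : α → ℕ) : ℕ → (ℕ → α) → ℕ
  | 0, _ => 0
  | n + 1, x => 2 ^ 13 * concatCode E n (fun j => x (1 + j)) + E (x 0)

theorem concatCode_mem {E : α → ℕ} {Es : List ℕ} (hE : ∀ a, E a ∈ Es) (n : ℕ) (x : ℕ → α) :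
    concatCode E n x ∈ concatCodes Es n := by
  induction n generalizing x with
  | zero => simp [concatCode, concatCodes]
  | succ n ih =>
    simp only [concatCode, concatCodes, List.mem_flatMap, List.mem_map]
    exact ⟨_, ih _, _, hE _, rfl⟩

theorem testBit_concatCode {E : α → ℕ} (hE : ∀ a, E a < 2 ^ 13) {n i : ℕ} (hi : i < 13 * n)
    (x : ℕ → α) :
    (concatCode E n x).testBit i = substSeq (fun a t => (E a).testBit t) 13 x i := by
  induction n generalizing x i with
  | zero => omega
  | succ n ih =>
    rw [concatCode, Nat.testBit_two_pow_mul_add _ (hE _)]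
    split
    · rename_i h
      simp [substSeq, Nat.div_eq_of_lt h, Nat.mod_eq_of_lt h]
    · rename_i h
      obtain ⟨k, rfl⟩ := Nat.exists_eq_add_of_le (not_lt.1 h)
      have := substSeq_mul_add (σ := fun a t => (E a).testBit t) (ℓ := 13) (by norm_num) x 1 k
      rw [one_mul] at this
      rw [this, ← ih (by omega)]
      simp

/-- The bits of `c ^^^ (c >>> p)` mark the mismatches between positions `p` apart. A cube at `s`
would leave `2 * p` consecutive bits clear from `s` on, hence bit `s` of the smear clear. -/
theorem not_isCubeAt_of_noCubeTest {E : α → ℕ} {Es : List ℕ} (hmem : ∀ a, E a ∈ Es)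
    (hE : ∀ a, E a < 2 ^ 13) {p N : ℕ} {ks : List ℕ} (h : noCubeTest Es p N ks = true)
    (x : ℕ → α) {s : ℕ} (hs : s < 13) :
    ¬ IsCubeAt (substSeq (fun a t => (E a).testBit t) 13 x) s p := by
  intro hc
  simp only [noCubeTest, Bool.and_eq_true, decide_eq_true_eq, List.all_eq_true, beq_iff_eq] at h
  obtain ⟨⟨hN, hks⟩, h⟩ := h
  have hz := h _ (concatCode_mem hmem N x)
  have h0 := smear_testBit_eq_false (s := s)
    (d := concatCode E N x ^^^ (concatCode E N x >>> p)) (fun i hi => by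
      rw [Nat.testBit_xor, Nat.testBit_shiftRight, testBit_concatCode hE (by omega),
        testBit_concatCode hE (by omega), hc i hi, show p + (s + i) = s + i + p by omega]
      simp) hks
  have h1 := congrArg (fun z => Nat.testBit z s) hz
  simp only [Nat.testBit_mod_two_pow, Nat.testBit_two_pow_sub_one, h0] at h1
  simp [hs] at h1

theorem exists_ne_of_syncTest {E : α → ℕ} {Es : List ℕ} (hmem : ∀ a, E a ∈ Es)
    (hE : ∀ a, E a < 2 ^ 13) {m : ℕ} (h : syncTest Es m = true) (x x' : ℕ → α) {r : ℕ}
    (hr0 : 0 < r) (hr : r < 13) :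
    ∃ t < m * 13, substSeq (fun a t => (E a).testBit t) 13 x t ≠
      substSeq (fun a t => (E a).testBit t) 13 x' (r + t) := by
  simp only [syncTest, List.all_eq_true, bne_iff_ne, List.mem_range] at h
  have hne := h _ (concatCode_mem hmem m x) _ (concatCode_mem hmem (m + 1) x') (r - 1) (by omega)
  rw [Nat.sub_add_cancel hr0] at hne
  by_contra! hall
  refine hne (Nat.eq_of_testBit_eq fun t => ?_)
  rw [Nat.testBit_mod_two_pow, Nat.testBit_mod_two_pow]
  by_cases ht : t < 13 * m
  · rw [Nat.testBit_shiftRight, testBit_concatCode hE ht, testBit_concatCode hE (by omega),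
      hall t (by omega)]
  · simp [ht]

theorem eq_of_testBit_eq_of_lt {a b : ℕ} (ha : a < 2 ^ 13) (hb : b < 2 ^ 13)
    (h : ∀ t < 13, a.testBit t = b.testBit t) : a = b := by
  refine Nat.eq_of_testBit_eq fun t => ?_
  by_cases ht : t < 13
  · exact h t ht
  · have : 2 ^ 13 ≤ 2 ^ t := Nat.pow_le_pow_right (by norm_num) (by omega)
    rw [Nat.testBit_lt_two_pow (by omega), Nat.testBit_lt_two_pow (by omega)]

theorem eq_or_eq_of_borderTest {E : α → ℕ} {Es : List ℕ} (hmem : ∀ a, E a ∈ Es)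
    (hE : ∀ a, E a < 2 ^ 13) (h : borderTest Es = true) (a b c : α) {r : ℕ} (hr : r < 13)
    (hb : ∀ t, r ≤ t → t < 13 → (E b).testBit t = (E a).testBit t)
    (hc : ∀ t < r, (E a).testBit t = (E c).testBit t) : E b = E a ∨ E a = E c := by
  simp only [borderTest, List.all_eq_true, List.mem_range] at h
  have h1 := h _ (hmem a) _ (hmem b) _ (hmem c) r hr
  have e1 : E b >>> r = E a >>> r := Nat.eq_of_testBit_eq fun t => by
    rw [Nat.testBit_shiftRight, Nat.testBit_shiftRight]
    by_cases ht : r + t < 13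
    · exact hb _ (by omega) ht
    · have : 2 ^ 13 ≤ 2 ^ (r + t) := Nat.pow_le_pow_right (by norm_num) (by omega)
      have := hE a
      have := hE b
      rw [Nat.testBit_lt_two_pow (by omega), Nat.testBit_lt_two_pow (by omega)]
  have e2 : E a % 2 ^ r = E c % 2 ^ r := Nat.eq_of_testBit_eq fun t => by
    rw [Nat.testBit_mod_two_pow, Nat.testBit_mod_two_pow]
    by_cases ht : t < r
    · rw [hc t ht]
    · simp [ht]
  simpa [e1, e2] using h1

/-- All the finite tests, with a list of parameters for `noCubeTest`. -/
def morphismTest (Es : List ℕ) (m P : ℕ) (rows : List (ℕ × ℕ × List ℕ)) : Bool :=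
  decide ((m + 1) * 13 ≤ 2 * P + 1) && Es.all (· < 2 ^ 13) && syncTest Es m && borderTest Es &&
    (rows.all fun q => noCubeTest Es q.1 q.2.1 q.2.2) &&
    (List.range P).all fun p => p % 13 == 0 || rows.any fun q => q.1 == p

theorem exists_isCubeAt_of_morphismTest {E : α → ℕ} (hinj : Function.Injective E) {Es : List ℕ}
    (hmem : ∀ a, E a ∈ Es) {m P : ℕ} {rows : List (ℕ × ℕ × List ℕ)}
    (h : morphismTest Es m P rows = true) {x : ℕ → α} {s p : ℕ} (hp : 0 < p)
    (hc : IsCubeAt (substSeq (fun a t => (E a).testBit t) 13 x) s p) :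
    ∃ j q, 0 < q ∧ IsCubeAt x j q ∧ (j + 3 * q) * 13 < s + 3 * p + 13 := by
  simp only [morphismTest, Bool.and_eq_true] at h
  obtain ⟨⟨⟨⟨⟨hmP, hlt⟩, hsync⟩, hborder⟩, hrows⟩, hcover⟩ := h
  have hE : ∀ a, E a < 2 ^ 13 := fun a => by simpa using List.all_eq_true.1 hlt _ (hmem a)
  refine exists_isCubeAt_of_substSeq (m := m) (P := P) (by norm_num) (of_decide_eq_true hmP)
    ?_ ?_ ?_ ?_ hp hc
  · intro x s p hs hp hd
    have h1 := List.all_eq_true.1 hcover p (List.mem_range.2 hp)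
    have h2 : p % 13 ≠ 0 := fun h0 => hd (Nat.dvd_of_mod_eq_zero h0)
    simp only [Bool.or_eq_true, beq_iff_eq, h2, false_or, List.any_eq_true] at h1
    obtain ⟨q, hq, rfl⟩ := h1
    exact not_isCubeAt_of_noCubeTest hmem hE (List.all_eq_true.1 hrows q hq) x hs
  · intro x x' r hr0 hr
    exact exists_ne_of_syncTest hmem hE hsync x x' hr0 hr
  · intro a b hab
    exact hinj (eq_of_testBit_eq_of_lt (hE a) (hE b) hab)
  · intro a b c r hr hb hc
    exact (eq_or_eq_of_borderTest hmem hE hborder a b c hr hb hc).imp (@hinj _ _) (@hinj _ _)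

end

/-- For `m = 2`, 19 is the least `P` with `3 * 13 ≤ 2 * P + 1`. Each row treats one period, with
enough images to contain the cube. The shifts sum to `2 * p - 1` and their partial sums fill `0, …,
2 * p - 1`, so the whole comparison window is examined. -/
theorem morphismTest_rho : morphismTest [6564, 6500, 6452, 6738] 2 19
    [(1, 2, [1]), (2, 2, [1, 2]), (3, 2, [1, 2, 2]), (4, 2, [1, 2, 4]), (5, 3, [1, 2, 4, 2]),
      (6, 3, [1, 2, 4, 4]), (7, 3, [1, 2, 4, 6]), (8, 3, [1, 2, 4, 8]), (9, 3, [1, 2, 4, 8, 2]),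
      (10, 4, [1, 2, 4, 8, 4]), (11, 4, [1, 2, 4, 8, 6]), (12, 4, [1, 2, 4, 8, 8]),
      (14, 5, [1, 2, 4, 8, 12]), (15, 5, [1, 2, 4, 8, 14]), (16, 5, [1, 2, 4, 8, 16]),
      (17, 5, [1, 2, 4, 8, 16, 2]), (18, 6, [1, 2, 4, 8, 16, 4])] = true := by
  decide +kernel

/-- The codes in the second list are the bitwise complements of those in the first, which exchanges
0 and 1. -/
theorem morphismTest_five : ∀ Es ∈ [[6546, 4818, 6450, 4902, 4710], [1645, 3373, 1741, 3289, 3481]],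
    morphismTest Es 1 13
    [(1, 2, [1]), (2, 2, [1, 2]), (3, 2, [1, 2, 2]), (4, 2, [1, 2, 4]), (5, 3, [1, 2, 4, 2]),
      (6, 3, [1, 2, 4, 4]), (7, 3, [1, 2, 4, 6]), (8, 3, [1, 2, 4, 8]), (9, 3, [1, 2, 4, 8, 2]),
      (10, 4, [1, 2, 4, 8, 4]), (11, 4, [1, 2, 4, 8, 6]), (12, 4, [1, 2, 4, 8, 8])] = true := by
  decide +kernel

/-! ### Growth of cubefree words over five letters -/

section Counting

variable {α : Type*}

theorem finite_words [Finite α] (X : Set (List α)) (n : ℕ) : {w ∈ X | w.length = n}.Finite :=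
  (List.finite_length_eq α n).subset fun _ h => h.2

theorem isPowerFree_nil {k : ℕ} (hk : k ≠ 0) : IsPowerFree k ([] : List α) := by
  intro u hu h
  have := List.eq_nil_of_infix_nil h
  rw [List.flatten_eq_nil_iff] at this
  exact hu (this u (List.mem_replicate.2 ⟨hk, rfl⟩))

/-- Deleting the first two copies of `u` loses nothing, since the remainder still begins with `u`,
of known length `p`. The remainder is a suffix of `v`, hence cubefree. -/
theorem ncard_prefix_cubes_le [Finite α] (n p : ℕ) (hp : 0 < p) :
    {w : List α | (∃ a v, w = a :: v ∧ IsPowerFree 3 v ∧ v.length = n) ∧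
      ∃ u t, u.length = p ∧ w = u ++ (u ++ (u ++ t))}.ncard ≤
    complexity {w : List α | IsPowerFree 3 w} (n + 1 - 2 * p) := by
  refine Set.ncard_le_ncard_of_injOn (fun w => w.drop (2 * p)) ?_ ?_ (finite_words _ _)
  · rintro w ⟨⟨a, v, rfl, hv, hl⟩, -⟩
    refine ⟨hv.of_isInfix ?_, by simp [hl]⟩
    obtain ⟨k, hk⟩ : ∃ k, 2 * p = k + 1 := ⟨2 * p - 1, by omega⟩
    simp only [hk, List.drop_succ_cons]
    exact (List.drop_suffix k v).isInfix
  · rintro w ⟨-, u, t, hu, rfl⟩ w' ⟨-, u', t', hu', rfl⟩ h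
    have hd : ∀ (u t : List α), u.length = p → (u ++ (u ++ (u ++ t))).drop (2 * p) = u ++ t := by
      intro u t hu
      rw [← List.append_assoc, List.drop_left' (by simp; omega)]
    simp only [hd u t hu, hd u' t' hu'] at h
    obtain ⟨rfl, rfl⟩ := List.append_inj h (hu.trans hu'.symm)
    rfl

/-- Prepend an arbitrary letter to a cubefree word. If a cube arises, it is a prefix, and
`ncard_prefix_cubes_le` bounds these failures for each period. -/
theorem card_mul_complexity_le [Finite α] (n : ℕ) :
    Nat.card α * complexity {w : List α | IsPowerFree 3 w} n ≤
      complexity {w : List α | IsPowerFree 3 w} (n + 1) +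
        ∑ p ∈ Finset.Icc 1 ((n + 1) / 3),
          complexity {w : List α | IsPowerFree 3 w} (n + 1 - 2 * p) := by
  set C : Set (List α) := {w | IsPowerFree 3 w ∧ w.length = n}
  set B : ℕ → Set (List α) := fun p =>
    {w | (∃ a v, w = a :: v ∧ IsPowerFree 3 v ∧ v.length = n) ∧
      ∃ u t, u.length = p ∧ w = u ++ (u ++ (u ++ t))}
  have h1 : Nat.card α * complexity {w : List α | IsPowerFree 3 w} n =
      ((Set.univ : Set α) ×ˢ C).ncard := by
    rw [Set.ncard_prod, Set.ncard_univ]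
    rfl
  have hBf : ∀ p, (B p).Finite := fun p =>
    (List.finite_length_eq α (n + 1)).subset (by
      rintro w ⟨⟨a, v, rfl, -, hl⟩, -⟩
      simp [hl])
  have h2 : ((Set.univ : Set α) ×ˢ C).ncard ≤
      ({w : List α | IsPowerFree 3 w ∧ w.length = n + 1} ∪
        ⋃ p ∈ Finset.Icc 1 ((n + 1) / 3), B p).ncard := by
    refine Set.ncard_le_ncard_of_injOn (fun q => q.1 :: q.2) ?_ ?_ ?_
    · rintro ⟨a, v⟩ ⟨-, hv, (hl : v.length = n)⟩
      by_cases hpf : IsPowerFree 3 (a :: v)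
      · exact Or.inl ⟨hpf, by simp [hl]⟩
      · right
        simp only [IsPowerFree, not_forall, not_not] at hpf
        obtain ⟨u, hu, hin⟩ := hpf
        rcases List.infix_cons_iff.1 hin with ⟨t, ht⟩ | hin
        · have hu0 := List.length_pos_iff.2 hu
          have ht' : a :: v = u ++ (u ++ (u ++ t)) := by
            rw [← ht]; simp [List.replicate]
          have hlen := congrArg List.length ht'
          simp only [List.length_cons, List.length_append] at hlen
          simp only [Set.mem_iUnion]
          refine ⟨u.length, Finset.mem_Icc.2 ⟨hu0, ?_⟩, ⟨a, v, rfl, hv, hl⟩, u, t, rfl, ht'⟩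
          rw [Nat.le_div_iff_mul_le (by norm_num)]
          omega
        · exact absurd hin (hv u hu)
    · rintro ⟨a, v⟩ - ⟨a', v'⟩ - h
      simpa using h
    · exact (finite_words {w | IsPowerFree 3 w} (n + 1)).union
        ((Finset.finite_toSet _).biUnion fun p _ => hBf p)
  rw [h1]
  refine h2.trans ((Set.ncard_union_le _ _).trans (add_le_add le_rfl ?_))
  refine (Finset.set_ncard_biUnion_le _ _).trans (Finset.sum_le_sum fun p hp => ?_)
  exact ncard_prefix_cubes_le n p (Finset.mem_Icc.1 hp).1

theorem sum_half_pow_le (M : ℕ) : ∑ p ∈ Finset.Icc 1 M, (1 / 2 : ℝ) ^ (p + 1) ≤ 1 / 2 := by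
  have h : ∑ p ∈ Finset.Icc 1 M, (1 / 2 : ℝ) ^ (p + 1) = 1 / 2 - (1 / 2) ^ (M + 1) := by
    induction M with
    | zero => norm_num
    | succ M ih =>
      rw [Finset.sum_Icc_succ_top (by omega), ih]
      ring
  rw [h]
  have : (0 : ℝ) ≤ (1 / 2) ^ (M + 1) := by positivity
  linarith

/-- Inductively, `c (n - j) ≤ (2 / 9) ^ j * c n`. The term for `p` is thus at most `(2 / 9) ^ (2 * p
- 1) * c n ≤ (1 / 2) ^ (p + 1) * c n`, and these sum to at most `c n / 2`, leaving `5 - 1 / 2 = 9 /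
2`. -/
theorem growth_of_recursion {c : ℕ → ℝ} (hc : ∀ n, 0 ≤ c n)
    (h : ∀ n, 5 * c n ≤ c (n + 1) + ∑ p ∈ Finset.Icc 1 ((n + 1) / 3), c (n + 1 - 2 * p)) (n : ℕ) :
    9 / 2 * c n ≤ c (n + 1) := by
  induction n using Nat.strong_induction_on with
  | _ n ih =>
    have hj : ∀ j ≤ n, c (n - j) ≤ (2 / 9) ^ j * c n := by
      intro j hj
      induction j with
      | zero => simp
      | succ j ihj =>
        have h1 := ih (n - (j + 1)) (by omega)
        rw [show n - (j + 1) + 1 = n - j by omega] at h1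
        have h2 := ihj (by omega)
        rw [pow_succ']
        linarith
    have hsum : ∑ p ∈ Finset.Icc 1 ((n + 1) / 3), c (n + 1 - 2 * p) ≤ 1 / 2 * c n := by
      calc _ ≤ ∑ p ∈ Finset.Icc 1 ((n + 1) / 3), (1 / 2 : ℝ) ^ (p + 1) * c n := by
            refine Finset.sum_le_sum fun p hp => ?_
            obtain ⟨hp1, hp2⟩ := Finset.mem_Icc.1 hp
            obtain ⟨k, rfl⟩ := Nat.exists_eq_add_of_le' hp1
            have h1 := hj (2 * k + 1) (by omega)
            rw [show n + 1 - 2 * (k + 1) = n - (2 * k + 1) by omega]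
            refine h1.trans (mul_le_mul_of_nonneg_right ?_ (hc n))
            have h2 : ((4 : ℝ) / 81) ^ k ≤ (1 / 2) ^ k :=
              pow_le_pow_left₀ (by norm_num) (by norm_num) k
            have h3 : (2 / 9 : ℝ) ^ (2 * k + 1) = 2 / 9 * (4 / 81) ^ k := by
              rw [pow_succ', pow_mul]; norm_num
            have h4 : (1 / 2 : ℝ) ^ (k + 1 + 1) = 1 / 4 * (1 / 2) ^ k := by ring
            have h5 : (0 : ℝ) ≤ (1 / 2) ^ k := by positivity
            rw [h3, h4]
            linarith
        _ ≤ 1 / 2 * c n := by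
            rw [← Finset.sum_mul]
            exact mul_le_mul_of_nonneg_right (sum_half_pow_le _) (hc n)
    linarith [h n]

theorem complexity_powerFree_growth (hα : Nat.card α = 5) (n : ℕ) :
    9 / 2 * (complexity {w : List α | IsPowerFree 3 w} n : ℝ) ≤
      complexity {w : List α | IsPowerFree 3 w} (n + 1) := by
  have : Finite α := Nat.finite_of_card_ne_zero (by omega)
  refine growth_of_recursion (c := fun n => (complexity {w : List α | IsPowerFree 3 w} n : ℝ))
    (fun n => Nat.cast_nonneg _) (fun n => ?_) n
  have := card_mul_complexity_le (α := α) n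
  rw [hα] at this
  exact_mod_cast this

theorem complexity_powerFree_add (hα : Nat.card α = 5) (n m : ℕ) :
    (9 / 2 : ℝ) ^ n * complexity {w : List α | IsPowerFree 3 w} m ≤
      complexity {w : List α | IsPowerFree 3 w} (n + m) := by
  induction n with
  | zero => simp
  | succ n ih =>
    have := complexity_powerFree_growth hα (n + m)
    rw [show n + 1 + m = n + m + 1 by omega, pow_succ]
    linarith

theorem complexity_powerFree_pos (hα : Nat.card α = 5) (n : ℕ) :
    0 < (complexity {w : List α | IsPowerFree 3 w} n : ℝ) := by
  have h0 : complexity {w : List α | IsPowerFree 3 w} 0 = 1 := by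
    rw [complexity, Set.ncard_eq_one]
    refine ⟨[], Set.ext fun w => ?_⟩
    simp only [Set.mem_ofPred_eq, List.length_eq_zero_iff, Set.mem_singleton_iff]
    exact ⟨fun h => h.2, fun h => ⟨h ▸ isPowerFree_nil (by norm_num), h⟩⟩
  have := complexity_powerFree_add hα n 0
  rw [h0] at this
  exact lt_of_lt_of_le (by positivity) this

/-- An element failing some `Q m` fails all later ones; finitely many elements have a common bound
for these thresholds. -/
theorem exists_forall_of_antitone {ι : Type*} {T : Set ι} (hT : T.Finite) {Q : ℕ → ι → Prop}
    (hQ : ∀ m w, Q (m + 1) w → Q m w) : ∃ M, ∀ w ∈ T, Q M w → ∀ m, Q m w := by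
  have hanti : ∀ w, Antitone fun m => Q m w := fun w => antitone_nat_of_succ_le fun m => hQ m w
  induction T, hT using Set.Finite.induction_on with
  | empty => exact ⟨0, by simp⟩
  | @insert a s _ _ ih =>
    obtain ⟨M, hM⟩ := ih
    by_cases ha : ∀ m, Q m a
    · exact ⟨M, by rintro w (rfl | hw) h; exacts [ha, hM w hw h]⟩
    · obtain ⟨m₀, h₀⟩ := not_forall.1 ha
      refine ⟨max M m₀, ?_⟩
      rintro w (rfl | hw) h
      · exact absurd (hanti _ (le_max_right _ _) h) h₀
      · exact hM w hw (hanti _ (le_max_left _ _) h)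

/-- The word `w` has a `3`-powerfree extension by `m` letters to the right. -/
def IsExtendable (m : ℕ) (w : List α) : Prop :=
  ∃ v : List α, v.length = m ∧ IsPowerFree 3 (w ++ v)

theorem IsExtendable.of_succ {m : ℕ} {w : List α} (h : IsExtendable (m + 1) w) :
    IsExtendable m w := by
  obtain ⟨v, hl, hv⟩ := h
  refine ⟨v.take m, by simp [hl], hv.of_isInfix ?_⟩
  exact ((List.prefix_append_right_inj w).2 (List.take_prefix m v)).isInfix

theorem exists_extendable_append [Finite α] {w : List α} (h : ∀ m, IsExtendable m w) :
    ∃ a, ∀ m, IsExtendable m (w ++ [a]) := by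
  obtain ⟨M, hM⟩ := exists_forall_of_antitone (Set.finite_univ (α := α))
    (Q := fun m a => IsExtendable m (w ++ [a])) (fun m a => IsExtendable.of_succ)
  obtain ⟨v, hl, hv⟩ := h (M + 1)
  obtain ⟨a, v, rfl⟩ := List.exists_cons_of_length_eq_add_one hl
  exact ⟨a, hM a trivial ⟨v, by simpa using hl, by simpa using hv⟩⟩

/-- Kőnig's lemma: append letters one at a time, keeping the word extendable by every length. Any
cube in the limit already lies in a finite stage. -/
theorem exists_powerFreeSeq_of_extendable [Finite α] {w : List α}
    (h : ∀ m, IsExtendable m w) : ∃ x : ℕ → α, IsPowerFreeSeq 3 x ∧ w = block x 0 w.length := by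
  have : Nonempty α := (exists_extendable_append h).nonempty
  choose! next hnext using fun (w : List α) (h : ∀ m, IsExtendable m w) =>
    exists_extendable_append h
  obtain ⟨W, hzero, hsucc⟩ : ∃ W : ℕ → List α, W 0 = w ∧ ∀ k, W (k + 1) = W k ++ [next (W k)] :=
    ⟨fun k => k.rec w fun _ v => v ++ [next v], rfl, fun _ => rfl⟩
  have hext : ∀ k m, IsExtendable m (W k) := by
    intro k
    induction k with
    | zero => rwa [hzero]
    | succ k ih => rw [hsucc]; exact hnext _ ih
  have hpf : ∀ k, IsPowerFree 3 (W k) := by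
    intro k
    obtain ⟨v, hl, hv⟩ := hext k 0
    rw [List.length_eq_zero_iff.1 hl, List.append_nil] at hv
    exact hv
  have hlen : ∀ k, (W k).length = w.length + k := by
    intro k
    induction k with
    | zero => rw [hzero]; rfl
    | succ k ih => rw [hsucc]; simp [ih]; omega
  have hpre : ∀ i j, i ≤ j → W i <+: W j := by
    intro i j hij
    induction j, hij using Nat.le_induction with
    | base => exact List.prefix_rfl
    | succ j _ ih => rw [hsucc]; exact ih.trans (List.prefix_append _ _)
  set x : ℕ → α := fun i => (W (i + 1))[i]'(by rw [hlen]; omega) with hx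
  have hblock : ∀ k, W k = block x 0 (w.length + k) := by
    intro k
    refine List.ext_getElem (by simp [hlen]) fun i hi _ => ?_
    rw [getElem_block]
    simp only [hx, Nat.zero_add]
    rcases le_total k (i + 1) with hk | hk
    · exact (hpre _ _ hk).getElem hi
    · exact ((hpre _ _ hk).getElem (by rw [hlen]; omega)).symm
  refine ⟨x, isPowerFreeSeq_iff.2 fun s p hp hc => ?_, hzero.symm.trans (hblock 0)⟩
  have h1 := hpf (s + 3 * p)
  rw [hblock] at h1
  exact isPowerFree_block_iff.1 h1 s p hp (by omega) (by simpa using hc)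

/-- There are at least `(9 / 2) ^ n` prefixes of length `n` of infinite cubefree words over five
letters. -/
theorem pow_le_ncard_prefixes (hα : Nat.card α = 5) (n : ℕ) :
    (9 / 2 : ℝ) ^ n ≤ {w : List α | ∃ x, IsPowerFreeSeq 3 x ∧ w = block x 0 n}.ncard := by
  have : Finite α := Nat.finite_of_card_ne_zero (by omega)
  obtain ⟨M, hM⟩ := exists_forall_of_antitone (List.finite_length_eq α n)
    (Q := IsExtendable) (fun m a => IsExtendable.of_succ)
  set S : Set (List α) := {w | ∃ x, IsPowerFreeSeq 3 x ∧ w = block x 0 n}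
  have hSf : S.Finite := (List.finite_length_eq α n).subset (by rintro w ⟨x, -, rfl⟩; simp)
  -- Split a cubefree word of length `n + M` after `n` letters. By the choice of `M`, its prefix
  -- extends to an infinite cubefree word. The lower bound `(9 / 2) ^ n` for the ratio of the two
  -- complexities then passes to `S`.
  have hle : complexity {w : List α | IsPowerFree 3 w} (n + M) ≤
      S.ncard * complexity {w : List α | IsPowerFree 3 w} M := by
    rw [complexity, complexity, ← Set.ncard_prod]
    refine Set.ncard_le_ncard_of_injOn (fun w => (w.take n, w.drop n)) ?_ ?_
      (hSf.prod (finite_words _ _))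
    · rintro w ⟨hw, hl⟩
      have hl1 : (w.take n).length = n := by simp [hl]
      refine ⟨?_, hw.of_isInfix (List.drop_suffix n w).isInfix, by simp [hl]⟩
      obtain ⟨x, hx, hxw⟩ := exists_powerFreeSeq_of_extendable
        (hM (w.take n) hl1 ⟨w.drop n, by simp [hl], by simpa using hw⟩)
      rw [hl1] at hxw
      exact ⟨x, hx, hxw⟩
    · intro w _ w' _ h
      rw [Prod.mk.injEq] at h
      rw [← List.take_append_drop n w, h.1, h.2, List.take_append_drop]
  have h1 := complexity_powerFree_add hα n M
  have h2 : (complexity {w : List α | IsPowerFree 3 w} (n + M) : ℝ) ≤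
      S.ncard * complexity {w : List α | IsPowerFree 3 w} M := by exact_mod_cast hle
  exact le_of_mul_le_mul_right (h1.trans h2) (complexity_powerFree_pos hα M)

end Counting

/-! ### Uniform morphisms and letter counts -/

section Uniform

variable {α β : Type*} {τ : α → List β} {ℓ : ℕ}

theorem IsUniform.length_flatMap (hτ : IsUniform ℓ τ) (w : List α) :
    (w.flatMap τ).length = ℓ * w.length := by
  induction w with
  | nil => simp
  | cons a w ih => rw [List.flatMap_cons, List.length_append, ih, hτ a, List.length_cons]; ring

theorem count_flatMap_of_const [DecidableEq β] {b : β} {k : ℕ} (hk : ∀ a, (τ a).count b = k)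
    (w : List α) : (w.flatMap τ).count b = k * w.length := by
  induction w with
  | nil => simp
  | cons a w ih => rw [List.flatMap_cons, List.count_append, ih, hk a, List.length_cons]; ring

theorem IsUniform.flatMap_injective (hτ : IsUniform ℓ τ) (hℓ : 0 < ℓ)
    (hinj : Function.Injective τ) : Function.Injective fun w : List α => w.flatMap τ := by
  intro v w h
  have hl := congrArg List.length h
  simp only [hτ.length_flatMap] at hl
  have hl' := Nat.eq_of_mul_eq_mul_left hℓ hl
  clear hl
  induction v generalizing w with
  | nil => exact (List.length_eq_zero_iff.1 hl'.symm).symm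
  | cons a v ih =>
    obtain ⟨b, w, rfl⟩ := List.exists_cons_of_length_eq_add_one hl'.symm
    simp only [List.flatMap_cons] at h
    obtain ⟨h1, h2⟩ := List.append_inj h ((hτ a).trans (hτ b).symm)
    rw [hinj h1, ih h2 (by simpa using hl')]

theorem IsUniform.freq_flatMap [DecidableEq β] (hτ : IsUniform ℓ τ) {b : β} {k : ℕ}
    (hk : ∀ a, (τ a).count b = k) {w : List α} (hw : w ≠ []) :
    freq b (w.flatMap τ) = k / ℓ := by
  have : (w.length : ℝ) ≠ 0 := by simpa using hw
  rw [freq, hτ.length_flatMap, count_flatMap_of_const hk]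
  push_cast
  exact mul_div_mul_right _ _ this

end Uniform

/-! ### Letter frequencies in infinite words -/

section Frequency

variable {β : Type*} [DecidableEq β]

theorem count_block_add (b : β) (x : ℕ → β) (i m n : ℕ) :
    (block x i (m + n)).count b = (block x i m).count b + (block x (i + m) n).count b := by
  rw [block_add, List.count_append]

/-- For prefixes only the incomplete last block of length `ℓ` contributes to the error; a factor is
a difference of two prefixes. The bound does not depend on `s`, so the frequencies converge along
every choice of factors. -/
theorem abs_count_block_le {b : β} {x : ℕ → β} {k ℓ : ℕ} (hℓ : 0 < ℓ)
    (hx : ∀ q, (block x 0 (ℓ * q)).count b = k * q) (s n : ℕ) :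
    |(ℓ * (block x s n).count b - k * n : ℝ)| ≤ 2 * ((ℓ + k) * ℓ) := by
  have h0 : ∀ N, |(ℓ * (block x 0 N).count b - k * N : ℝ)| ≤ (ℓ + k) * ℓ := by
    intro N
    have hr : N % ℓ < ℓ := Nat.mod_lt N hℓ
    have hN : N = ℓ * (N / ℓ) + N % ℓ := (Nat.div_add_mod N ℓ).symm
    generalize N / ℓ = q at hN
    generalize N % ℓ = r at hN hr
    subst hN
    have h1 : (block x (0 + ℓ * q) r).count b ≤ r :=
      List.count_le_length.trans (length_block _ _ _).le
    rw [count_block_add, hx]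
    generalize (block x (0 + ℓ * q) r).count b = t at h1
    have ht : (t : ℝ) ≤ ℓ := by exact_mod_cast h1.trans hr.le
    have hr' : (r : ℝ) ≤ ℓ := by exact_mod_cast hr.le
    have ht0 : (0 : ℝ) ≤ t := Nat.cast_nonneg t
    have hr0 : (0 : ℝ) ≤ r := Nat.cast_nonneg r
    have hk0 : (0 : ℝ) ≤ k := Nat.cast_nonneg k
    have hl0 : (0 : ℝ) ≤ ℓ := Nat.cast_nonneg ℓ
    push_cast
    have e : (ℓ * (k * q + t) - k * (ℓ * q + r) : ℝ) = ℓ * t - k * r := by ring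
    rw [e, abs_le]
    constructor <;> nlinarith
  have h1 := h0 (s + n)
  have h2 := h0 s
  rw [count_block_add, zero_add] at h1
  push_cast at h1
  have e : (ℓ * (block x s n).count b - k * n : ℝ) =
      (ℓ * ((block x 0 s).count b + (block x s n).count b) - k * (s + n)) -
        (ℓ * (block x 0 s).count b - k * s) := by ring
  rw [e]
  exact (abs_sub _ _).trans (by linarith)

theorem tendsto_freq_block {b : β} {x : ℕ → β} {k ℓ : ℕ} (hℓ : 0 < ℓ)
    (hx : ∀ q, (block x 0 (ℓ * q)).count b = k * q) (s : ℕ → ℕ) :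
    Filter.Tendsto (fun n => freq b (block x (s n) n)) Filter.atTop (nhds (k / ℓ)) := by
  rw [tendsto_iff_dist_tendsto_zero]
  have hl : (0 : ℝ) < ℓ := by exact_mod_cast hℓ
  refine squeeze_zero' (.of_forall fun _ => dist_nonneg) ?_
    (tendsto_const_div_atTop_nhds_zero_nat (2 * ((ℓ + k) * ℓ) / ℓ : ℝ))
  filter_upwards [Filter.eventually_gt_atTop 0] with n hn
  have hn' : (0 : ℝ) < n := by exact_mod_cast hn
  have h := abs_count_block_le hℓ hx (s n) n
  rw [freq, length_block, Real.dist_eq, div_sub_div _ _ hn'.ne' hl.ne', abs_div,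
    abs_of_pos (mul_pos hn' hl), div_div, mul_comm (n : ℝ) (ℓ : ℝ), mul_comm _ (ℓ : ℝ),
    mul_comm (n : ℝ) (k : ℝ)]
  gcongr

theorem hasFreq_of_count_block {b : β} {x : ℕ → β} {k ℓ : ℕ} (hℓ : 0 < ℓ)
    (hx : ∀ q, (block x 0 (ℓ * q)).count b = k * q) : HasFreq b x (k / ℓ) := by
  constructor
  · simp only [upperFreq, fun s => (tendsto_freq_block hℓ hx s).limsup_eq, ciSup_const]
  · simp only [lowerFreq, fun s => (tendsto_freq_block hℓ hx s).liminf_eq, ciInf_const]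

end Frequency

/-! ### Existence and lower bounds of entropy -/

section Entropy

variable {α : Type*}

theorem complexity_add_le [Finite α] {X : Set (List α)} (hX : IsFactorial X) (m n : ℕ) :
    complexity X (m + n) ≤ complexity X m * complexity X n := by
  rw [complexity, complexity, complexity, ← Set.ncard_prod]
  refine Set.ncard_le_ncard_of_injOn (fun w => (w.take m, w.drop m)) ?_ ?_
    ((finite_words _ _).prod (finite_words _ _))
  · rintro w ⟨hw, hl⟩
    exact ⟨⟨hX w hw _ (List.take_prefix m w).isInfix, by simp [hl]⟩,
      hX w hw _ (List.drop_suffix m w).isInfix, by simp [hl]⟩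
  · intro w _ w' _ h
    rw [Prod.mk.injEq] at h
    rw [← List.take_append_drop m w, h.1, h.2, List.take_append_drop]

/-- Fekete's lemma, as cutting words in two makes the logarithm of the complexity subadditive. -/
theorem exists_hasEntropy [Finite α] {X : Set (List α)} (hX : IsFactorial X)
    (hpos : ∀ n, 0 < complexity X n) : ∃ h, HasEntropy X h := by
  have hsub : Subadditive fun n => Real.log (complexity X n) := by
    intro m n
    have hm : (complexity X m : ℝ) ≠ 0 := by exact_mod_cast (hpos m).ne'
    have hn : (complexity X n : ℝ) ≠ 0 := by exact_mod_cast (hpos n).ne'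
    rw [← Real.log_mul hm hn]
    exact Real.log_le_log (by exact_mod_cast hpos _) (by exact_mod_cast complexity_add_le hX m n)
  refine ⟨_, hsub.tendsto_lim ⟨0, ?_⟩⟩
  rintro _ ⟨n, rfl⟩
  exact div_nonneg (Real.log_natCast_nonneg _) (Nat.cast_nonneg n)

theorem log_two_div_six_le {c n : ℕ} (hn : 0 < n) (h : (9 / 2 : ℝ) ^ n ≤ c) :
    Real.log 2 / 6 ≤ Real.log c / (13 * n : ℕ) := by
  have h1 : 13 * Real.log 2 ≤ 6 * Real.log (9 / 2) := by
    -- `2 ^ 13 = 8192`, while `(9 / 2) ^ 6` exceeds 8303.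
    have := Real.log_le_log (x := 2 ^ 13) (y := (9 / 2) ^ 6) (by norm_num) (by norm_num)
    rw [Real.log_pow, Real.log_pow] at this
    exact_mod_cast this
  have h2 := Real.log_le_log (by positivity) h
  rw [Real.log_pow] at h2
  have hn' : (0 : ℝ) < n := by exact_mod_cast hn
  push_cast
  rw [div_le_div_iff₀ (by norm_num) (by positivity)]
  nlinarith

theorem infinite_of_complexity {X : Set (List α)} (h : ∀ n, 0 < n → 0 < complexity X (13 * n)) :
    X.Infinite := by
  refine Set.Infinite.of_image List.length (Set.infinite_of_forall_exists_gt fun n => ?_)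
  obtain ⟨w, hw, hl⟩ := Set.nonempty_of_ncard_ne_zero (h (n + 1) (by omega)).ne'
  exact ⟨w.length, ⟨w, hw, rfl⟩, by omega⟩

theorem isFactorial_factorsWithFreq [DecidableEq α] (k : ℕ) (f : α → ℝ) :
    IsFactorial (factorsWithFreq k f) := by
  rintro w ⟨x, hx, hf, i, n, rfl⟩ v hv
  obtain ⟨j, -, hj⟩ := exists_eq_block_of_isInfix hv
  exact ⟨x, hx, hf, _, _, hj⟩

end Entropy

/-! ### Transfer to binary words -/

section BinaryImages

variable {α : Type*}

/-- The image of an infinite word under the morphism which maps `a` to `binaryWord (E a)`. -/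
def imageSeq (E : α → ℕ) (x : ℕ → α) : ℕ → Fin 2 :=
  fun i => if substSeq (fun a t => (E a).testBit t) 13 x i then 1 else 0

theorem isUniform_binaryWord (E : α → ℕ) : IsUniform 13 fun a => binaryWord (E a) :=
  fun a => by simp [binaryWord]

theorem binaryWord_eq_block (E : α → ℕ) (x : ℕ → α) (j : ℕ) :
    binaryWord (E (x j)) = block (imageSeq E x) (13 * j) 13 := by
  refine List.ext_getElem (by simp [binaryWord]) fun t ht _ => ?_
  have ht' : t < 13 := by simpa [binaryWord] using ht
  rw [getElem_block, imageSeq, mul_comm, substSeq_mul_add_of_lt (by norm_num) x j ht']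
  simp only [binaryWord, List.getElem_ofFn]

theorem flatMap_block (E : α → ℕ) (x : ℕ → α) (j n : ℕ) :
    (block x j n).flatMap (fun a => binaryWord (E a)) =
      block (imageSeq E x) (13 * j) (13 * n) := by
  induction n generalizing j with
  | zero => simp [block]
  | succ n ih =>
    have h1 : block x j 1 = [x j] := by simp [block]
    rw [show n + 1 = 1 + n by omega, block_add, List.flatMap_append, ih, h1,
      List.flatMap_singleton, binaryWord_eq_block, show 13 * (1 + n) = 13 + 13 * n by ring,
      block_add, show 13 * (j + 1) = 13 * j + 13 by ring]

theorem IsCubeAt.of_imageSeq {E : α → ℕ} {x : ℕ → α} {s p : ℕ}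
    (h : IsCubeAt (imageSeq E x) s p) :
    IsCubeAt (substSeq (fun a t => (E a).testBit t) 13 x) s p := by
  intro i hi
  have := h i hi
  simp only [imageSeq] at this
  split_ifs at this with h1 h2 h2 <;> simp_all

theorem binaryWord_injective {E : α → ℕ} (hinj : Function.Injective E) (hE : ∀ a, E a < 2 ^ 13) :
    Function.Injective fun a => binaryWord (E a) := by
  intro a b h
  refine hinj (eq_of_testBit_eq_of_lt (hE a) (hE b) fun t ht => ?_)
  have := congrFun (List.ofFn_injective h) ⟨t, ht⟩
  simp only at this
  split_ifs at this with h1 h2 h2 <;> simp_all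

/-- Cubes in the images of infinite words come from cubes in the preimages. -/
def ReflectsCubes (E : α → ℕ) : Prop :=
  ∀ x s p, 0 < p → IsCubeAt (imageSeq E x) s p →
    ∃ j q, 0 < q ∧ IsCubeAt x j q ∧ (j + 3 * q) * 13 < s + 3 * p + 13

theorem reflectsCubes_of_morphismTest {E : α → ℕ} (hinj : Function.Injective E) {Es : List ℕ}
    (hmem : ∀ a, E a ∈ Es) {m P : ℕ} {rows : List (ℕ × ℕ × List ℕ)}
    (h : morphismTest Es m P rows = true) : ReflectsCubes E :=
  fun _ _ _ hp hc => exists_isCubeAt_of_morphismTest hinj hmem h hp hc.of_imageSeq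

theorem ReflectsCubes.isPowerFreeMorphism {E : α → ℕ} (h : ReflectsCubes E) [Inhabited α] :
    IsPowerFreeMorphism 3 fun a => binaryWord (E a) := by
  intro w hw
  obtain ⟨x, hx⟩ := exists_eq_block w
  rw [hx] at hw ⊢
  rw [flatMap_block]
  refine isPowerFree_block_iff.2 fun s p hp hs hc => ?_
  obtain ⟨j, q, hq, hcube, hlt⟩ := h x _ p hp hc
  -- The image has length `13 * w.length`, so the bound from `h` yields `j + 3 * q ≤ w.length`: the
  -- cube of `x` lies within `w`.
  exact isPowerFree_block_iff.1 hw j q hq (by omega) (by simpa using hcube)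

theorem ReflectsCubes.isPowerFreeSeq {E : α → ℕ} (h : ReflectsCubes E) {x : ℕ → α}
    (hx : IsPowerFreeSeq 3 x) : IsPowerFreeSeq 3 (imageSeq E x) := by
  rw [isPowerFreeSeq_iff] at hx ⊢
  intro s p hp hc
  obtain ⟨j, q, hq, hcube, -⟩ := h x s p hp hc
  exact hx j q hq hcube

variable {E : α → ℕ} {k : Fin 2 → ℕ}

theorem pow_le_complexity_wordsWithFreq (hα : Nat.card α = 5) (h : ReflectsCubes E)
    (hinj : Function.Injective fun a => binaryWord (E a))
    (hk : ∀ a b, (binaryWord (E a)).count b = k b) {n : ℕ} (hn : 0 < n) :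
    (9 / 2 : ℝ) ^ n ≤ complexity (wordsWithFreq 3 fun b => (k b / 13 : ℝ)) (13 * n) := by
  have hne : Nonempty α := (Nat.card_ne_zero.1 (by omega)).1
  have : Inhabited α := ⟨hne.some⟩
  have h1 := complexity_powerFree_add hα n 0
  have h2 : 1 ≤ (complexity {w : List α | IsPowerFree 3 w} 0 : ℝ) := by
    exact_mod_cast complexity_powerFree_pos hα 0
  have h3 : (9 / 2 : ℝ) ^ n ≤ complexity {w : List α | IsPowerFree 3 w} n :=
    (le_mul_of_one_le_right (by positivity) h2).trans h1
  refine h3.trans (Nat.cast_le.2 ?_)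
  have hu := isUniform_binaryWord E
  refine Set.ncard_le_ncard_of_injOn (fun w => w.flatMap fun a => binaryWord (E a)) ?_
    (hu.flatMap_injective (by norm_num) hinj).injOn (finite_words _ _)
  rintro w ⟨hw, rfl⟩
  refine ⟨⟨h.isPowerFreeMorphism w hw, fun b => ?_⟩, hu.length_flatMap w⟩
  exact_mod_cast hu.freq_flatMap (fun a => hk a b) (List.length_pos_iff.1 hn)

theorem pow_le_complexity_factorsWithFreq (hα : Nat.card α = 5) (h : ReflectsCubes E)
    (hinj : Function.Injective fun a => binaryWord (E a))
    (hk : ∀ a b, (binaryWord (E a)).count b = k b) (n : ℕ) :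
    (9 / 2 : ℝ) ^ n ≤ complexity (factorsWithFreq 3 fun b => (k b / 13 : ℝ)) (13 * n) := by
  refine (pow_le_ncard_prefixes hα n).trans (Nat.cast_le.2 ?_)
  have hu := isUniform_binaryWord E
  refine Set.ncard_le_ncard_of_injOn (fun w => w.flatMap fun a => binaryWord (E a)) ?_
    (hu.flatMap_injective (by norm_num) hinj).injOn (finite_words _ _)
  rintro _ ⟨x, hx, rfl⟩
  refine ⟨⟨imageSeq E x, h.isPowerFreeSeq hx, fun b => ?_, 13 * 0, 13 * n, flatMap_block E x 0 n⟩,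
    by simp only [hu.length_flatMap, length_block]⟩
  have := hasFreq_of_count_block (b := b) (x := imageSeq E x) (k := k b) (ℓ := 13) (by norm_num)
    (fun q => by
      rw [show (0 : ℕ) = 13 * 0 by rfl, ← flatMap_block, count_flatMap_of_const fun a => hk a b,
        length_block])
  exact_mod_cast this

theorem log_two_div_six_le_lowerEntropy (hα : Nat.card α = 5) (h : ReflectsCubes E)
    (hinj : Function.Injective fun a => binaryWord (E a))
    (hk : ∀ a b, (binaryWord (E a)).count b = k b) (hcop : (k 0).Coprime 13) :
    ((Real.log 2 / 6 : ℝ) : EReal) ≤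
      lowerEntropy (wordsWithFreq 3 fun b => (k b / 13 : ℝ)) := by
  refine Filter.le_liminf_of_le (by isBoundedDefault) ?_
  rw [Filter.eventually_inf_principal]
  filter_upwards [Filter.eventually_gt_atTop 0] with n hn
  rintro ⟨w, ⟨-, hw⟩, rfl⟩
  have hl : (w.length : ℝ) ≠ 0 := by exact_mod_cast hn.ne'
  have h0 := hw 0
  rw [freq, div_eq_div_iff hl (by norm_num)] at h0
  have h1 : w.count 0 * 13 = k 0 * w.length := by exact_mod_cast h0
  -- The exact frequency `k 0 / 13` is in lowest terms, so only lengths divisible by 13 occur.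
  obtain ⟨m, hm⟩ := hcop.symm.dvd_of_dvd_mul_left (Dvd.intro_left _ h1)
  rw [hm]
  have hm0 : 0 < m := by omega
  exact EReal.coe_le_coe_iff.2
    (log_two_div_six_le hm0 (pow_le_complexity_wordsWithFreq hα h hinj hk hm0))

theorem entropy_of_morphism (hα : Nat.card α = 5) (h : ReflectsCubes E)
    (hinj : Function.Injective fun a => binaryWord (E a))
    (hk : ∀ a b, (binaryWord (E a)).count b = k b) (hcop : (k 0).Coprime 13)
    {f : Fin 2 → ℝ} (hf : f = fun b => (k b / 13 : ℝ)) :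
    ((wordsWithFreq 3 f).Infinite ∧
      ((Real.log 2 / 6 : ℝ) : EReal) ≤ lowerEntropy (wordsWithFreq 3 f)) ∧
    ((factorsWithFreq 3 f).Infinite ∧ IsFactorial (factorsWithFreq 3 f) ∧
      ∃ h : ℝ, HasEntropy (factorsWithFreq 3 f) h ∧ Real.log 2 / 6 ≤ h) := by
  subst hf
  have hpos : ∀ {c n : ℕ}, (9 / 2 : ℝ) ^ n ≤ c → 0 < c := fun {c n} hc => by
    exact_mod_cast lt_of_lt_of_le (by positivity : (0 : ℝ) < (9 / 2) ^ n) hc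
  have hpow := pow_le_complexity_factorsWithFreq hα h hinj hk
  have hfac := isFactorial_factorsWithFreq 3 fun b => (k b / 13 : ℝ)
  refine ⟨⟨infinite_of_complexity fun n hn =>
      hpos (pow_le_complexity_wordsWithFreq hα h hinj hk hn),
    log_two_div_six_le_lowerEntropy hα h hinj hk hcop⟩,
    infinite_of_complexity fun n _ => hpos (hpow n), hfac, ?_⟩
  obtain ⟨e, he⟩ := exists_hasEntropy hfac fun n => by
    have h1 := hpos (hpow n)
    rw [show 13 * n = n + 12 * n by ring] at h1
    -- Submultiplicativity carries positivity from length `13 * n` to length `n`.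
    exact Nat.pos_of_mul_pos_right (h1.trans_le (complexity_add_le hfac n (12 * n)))
  refine ⟨e, he, ?_⟩
  have hsub : Filter.Tendsto (fun n : ℕ => 13 * n) Filter.atTop Filter.atTop :=
    Filter.tendsto_id.const_mul_atTop' (by norm_num)
  refine ge_of_tendsto (he.comp hsub) ?_
  filter_upwards [Filter.eventually_gt_atTop 0] with n hn
  exact log_two_div_six_le hn (hpow n)

end BinaryImages

/-! ### The explicit morphisms -/

/-- The codes of the images of the letters under `rho`. -/
def rhoCode : Letter → ℕ
  | Letter.a11 => 6564
  | Letter.a12 => 6500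
  | Letter.a21 => 6452
  | Letter.a22 => 6738

theorem rho_eq_binaryWord : rho = fun a => binaryWord (rhoCode a) := by
  funext a
  cases a <;> decide

theorem isPowerFreeMorphism_rho : IsPowerFreeMorphism 3 rho := by
  rw [rho_eq_binaryWord]
  have : Inhabited Letter := ⟨Letter.a11⟩
  refine ReflectsCubes.isPowerFreeMorphism (reflectsCubes_of_morphismTest ?_ ?_ morphismTest_rho)
  · intro a b
    cases a <;> cases b <;> simp [rhoCode]
  · intro a
    cases a <;> simp [rhoCode]

end PowerFree

theorem mainTheorem4 : PowerFree.IsUniform 13 PowerFree.rho ∧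
    (∀ a, (PowerFree.rho a).count 0 = 7 ∧ (PowerFree.rho a).count 1 = 6) ∧
    PowerFree.IsPowerFreeMorphism 3 PowerFree.rho ∧
    (∀ w : List PowerFree.Letter, w ≠ [] →
      PowerFree.freq 0 (w.flatMap PowerFree.rho) = 7 / 13 ∧
      PowerFree.freq 1 (w.flatMap PowerFree.rho) = 6 / 13) ∧
    ∀ f : Fin 2 → ℝ, f = ![7 / 13, 6 / 13] ∨ f = ![6 / 13, 7 / 13] →
      ((PowerFree.wordsWithFreq 3 f).Infinite ∧
        ((Real.log 2 / 6 : ℝ) : EReal) ≤ PowerFree.lowerEntropy (PowerFree.wordsWithFreq 3 f)) ∧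
      ((PowerFree.factorsWithFreq 3 f).Infinite ∧
        PowerFree.IsFactorial (PowerFree.factorsWithFreq 3 f) ∧
        ∃ h : ℝ, PowerFree.HasEntropy (PowerFree.factorsWithFreq 3 f) h ∧
          Real.log 2 / 6 ≤ h) := by
  have hu : PowerFree.IsUniform 13 PowerFree.rho := fun a => by cases a <;> rfl
  have hcount : ∀ a, (PowerFree.rho a).count 0 = 7 ∧ (PowerFree.rho a).count 1 = 6 := fun a => by
    cases a <;> decide
  refine ⟨hu, hcount, PowerFree.isPowerFreeMorphism_rho, fun w hw => ⟨?_, ?_⟩, ?_⟩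
  · exact_mod_cast hu.freq_flatMap (fun a => (hcount a).1) hw
  · exact_mod_cast hu.freq_flatMap (fun a => (hcount a).2) hw
  rintro f (rfl | rfl)
  · have hinj : Function.Injective ![6546, 4818, 6450, 4902, 4710] := by decide
    refine PowerFree.entropy_of_morphism (E := ![6546, 4818, 6450, 4902, 4710]) (k := ![7, 6]) (by simp)
      (PowerFree.reflectsCubes_of_morphismTest hinj (Es := [6546, 4818, 6450, 4902, 4710]) (by decide)
        (PowerFree.morphismTest_five _ (by simp)))
      (PowerFree.binaryWord_injective hinj (by decide)) (by decide) (by decide) ?_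
    funext b
    fin_cases b <;> simp
  · have hinj : Function.Injective ![1645, 3373, 1741, 3289, 3481] := by decide
    refine PowerFree.entropy_of_morphism (E := ![1645, 3373, 1741, 3289, 3481]) (k := ![6, 7]) (by simp)
      (PowerFree.reflectsCubes_of_morphismTest hinj (Es := [1645, 3373, 1741, 3289, 3481]) (by decide)
        (PowerFree.morphismTest_five _ (by simp)))
      (PowerFree.binaryWord_injective hinj (by decide)) (by decide) (by decide) ?_
    funext b
    fin_cases b <;> simp
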